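/- **Model.** Fix $n\ge 1$ and the vertex set $V=[n]$. A turnstile stream $\sigma$ is a finite sequence of tokens $(u,v,\Delta)$ with $u\ne v$ in $V$ and $\Delta\in\mathbb Z$; a token adds $\Delta$ to the multiplicity of the edge $\{u,v\}$ (all multiplicities are initially $0$). For $M\in\mathbb N$, the problem $\mathrm{TriangleCount}_{n,M}$ asks, for a stream whose final edge multiplicities $A(u,v)$ all lie in $\{0,\dots,M\}$, for the exact number of triangles of the final multigraph, counted with multiplicity: $T=\sum_{x<y<z}A(x,y)A(y,z)A(x,z)$. No condition is imposed on intermediate multiplicities, on the individual $\Delta$, or on the length of the stream. In a *scheme*, Verifier draws random coins $R$ uniformly from a finite set and has a memory of a fixed number of bits. He processes the stream $\sigma$ token by token, then a help message sent by Prover (who does not know $R$) bit by bit, and finally outputs an integer or $\bot$ (reject). Each step is an arbitrary function of $R$, the memory content and the item read. The scheme has vcost at most $v$ if the memory has at most $v$ bits. It has hcost at most $h$ and completeness error at most $\varepsilon_c$ if for every admissible $\sigma$ there is a help message of at most $h$ bits for which Verifier outputs $T$ with probability at least $1-\varepsilon_c$. It has soundness error at most $\varepsilon_s$ if for every admissible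 $\sigma$ and every help message whatsoever, Verifier outputs a value outside $\{T,\bot\}$ with probability at most $\varepsilon_s$. **Theorem (optimal tradeoff for laconic schemes).** 1. For any positive integers $t,s$ with $ts\ge n$ (in particular $ts=n$) there is a $[t,ns]$-scheme for triangle counting in turnstile streams with polynomially bounded final multiplicities. That is: for every $C\in\mathbb N$ there are $K,k\in\mathbb N$ such that for all integers $n,t,s\ge 1$ with $ts\ge n$ and all $M\le n^C$ there is a scheme for $\mathrm{TriangleCount}_{n,M}$ with hcost at most $K\,t\,(\lfloor\log_2 n\rfloor+1)^k$, vcost at most $K\,ns\,(\lfloor\log_2 n\rfloor+1)^k$, completeness error $0$ and soundness error at most $1/3$; moreover its random coins can be stored within the same bound $K\,ns\,(\lfloor\log_2 n\rfloor+1)^k$ on the number of bits. 2. For $ts=n$ (so that $t\cdot ns=n^2$) this is optimal up to logarithmic factors: there is a constant $c>0$ such that for all integers $n,M,h,v\ge1$, every scheme for $\mathrm{TriangleCount}_{n,M}$ with hcost at most $h$, vcost at most $v$ and completeness and soundness errors at most $1/3$ satisfies $hv\ge c\,n^2$. Here the random coins are not charged to $v$. -/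

import Mathlib

/-- A token of a turnstile graph stream on the vertex set `[n]`: the integer `amount`
(possibly negative) is added to the multiplicity of the edge `{fst, snd}`. -/
structure EdgeUpdate (n : ℕ) where
  fst : Fin n
  snd : Fin n
  ne : fst ≠ snd
  amount : ℤ

/-- The multiplicity of the edge `{a, b}` after the whole stream `σ` has been applied
to the empty graph. -/
def edgeMultiplicity {n : ℕ} (σ : List (EdgeUpdate n)) (a b : Fin n) : ℤ :=
  (σ.map fun e => if s(e.fst, e.snd) = s(a, b) then e.amount else 0).sum

/-- The turnstile streams whose final state is a multigraph in which every edge multiplicity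
is at most `M`. Nothing is asked of the intermediate states, of the individual amounts or of the
length of the stream. -/
def multigraphStreams (n M : ℕ) : Set (List (EdgeUpdate n)) :=
  {σ | ∀ a b : Fin n, 0 ≤ edgeMultiplicity σ a b ∧ edgeMultiplicity σ a b ≤ (M : ℤ)}

/-- The number of triangles (sets of three edges `{x, y}`, `{y, z}`, `{x, z}`, parallel edges
being distinct) of the final multigraph of the stream. -/
def triangleCount {n : ℕ} (σ : List (EdgeUpdate n)) : ℤ :=
  ∑ x : Fin n, ∑ y : Fin n, ∑ z : Fin n,
    if x < y ∧ y < z then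
      edgeMultiplicity σ x y * edgeMultiplicity σ y z * edgeMultiplicity σ x z
    else 0

/-- The Verifier of an (online) scheme. He draws `R` uniformly from `Fin coins` and has a working
memory of `space` bits. With it he first processes the input stream, one token after the other, and
then the help message, one bit after the other; finally he outputs a value, or `none`
(for "reject"). -/
structure Scheme (Token Out : Type) where
  coins : ℕ
  coins_pos : 0 < coins
  space : ℕ
  start : Fin coins → (Fin space → Bool)
  onToken : Fin coins → (Fin space → Bool) → Token → (Fin space → Bool)
  onHelpBit : Fin coins → (Fin space → Bool) → Bool → (Fin space → Bool)
  output : Fin coins → (Fin space → Bool) → Option Out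

namespace Scheme

variable {Token Out : Type}

/-- The content of Verifier's memory at the end of the input stream. -/
def summary (S : Scheme Token Out) (R : Fin S.coins) (σ : List Token) : Fin S.space → Bool :=
  σ.foldl (S.onToken R) (S.start R)

/-- Verifier's output on input stream `σ`, followed by the help message `m`. -/
def result (S : Scheme Token Out) (R : Fin S.coins) (σ : List Token) (m : List Bool) :
    Option Out :=
  S.output R (m.foldl (S.onHelpBit R) (S.summary R σ))

/-- The probability of the event `E` over Verifier's coins. -/
noncomputable def prob (S : Scheme Token Out) (E : Fin S.coins → Prop) : ℝ :=
  (Nat.card {R : Fin S.coins // E R} : ℝ) / (S.coins : ℝ)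

/-- Completeness error at most `ε` for the function `f` on the inputs in `D`, with help messages of
at most `h` bits. -/
def IsComplete (S : Scheme Token Out) (D : Set (List Token)) (f : List Token → Out)
    (h : ℕ) (ε : ℝ) : Prop :=
  ∀ σ ∈ D, ∃ m : List Bool, m.length ≤ h ∧
    1 - ε ≤ S.prob fun R => S.result R σ m = some (f σ)

/-- Soundness error at most `ε` for the function `f` on the inputs in `D`, against arbitrary help
messages. -/
def IsSound (S : Scheme Token Out) (D : Set (List Token)) (f : List Token → Out)
    (ε : ℝ) : Prop :=
  ∀ σ ∈ D, ∀ m : List Bool,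
    S.prob (fun R => S.result R σ m ≠ some (f σ) ∧ S.result R σ m ≠ none) ≤ ε

end Scheme

/-!
**The scheme.** A token with edge `{u, v}` and amount `Δ` changes the number of triangles by `Δ`
times the number of paths `u, w, v` in the current graph (`triangleCount_concat`). Lay the
vertices `w` out in a `t × s` grid and extend each row `u` of the current adjacency matrix,
restricted to a column `j` of the grid, to a polynomial `F u j` of degree less than `t` over
`ZMod q`; the number of these paths is then the sum over `{0, …, t - 1}` of the polynomial
`∑ j, F u j * F v j`. Summed over the tokens of the stream, this gives a polynomial `P` of degree
at most `2 * (t - 1)` whose values at `0, …, t - 1` add up to the number of triangles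
(`LaconicTriangle.exists_streamPoly`). Verifier draws a point `r` and maintains the `n * s` values
`F u j (r)`, which are linear in the stream, and with their help `P(r)`, which is not: it depends
on the order of the tokens. Prover sends the coefficients of `P`. While he reads them, Verifier
subtracts their contribution to the value at `r` and adds up their contribution to the sum over
`{0, …, t - 1}`; a message that encodes another polynomial of this degree passes the test at `r`
with probability at most `2 * (t - 1) / q`. A prime `q` of size polynomial in `n` exceeds all
numbers of triangles and makes this error at most `1/3`.

**Optimality.** The graph of a `p × p` bit matrix, followed by the two edges that join an
additional vertex to row `i` and column `j`, has a triangle exactly if the entry `(i, j)` is set,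
so that a scheme solves the index problem for `p ^ 2` bits. Run `12 * (h + 5)` independent copies
of it. By `card_half_bad_mul_le` the probability that at least half of them err on a given help
message is so small that a union bound over all messages of at most `h` bits applies: whether some
message convinces more than half of the copies can be decided without Prover, from the memory
contents at the end of the matrix alone. After fixing the best coins, these contents are an
encoding of the matrix from which a random entry is recovered with error at most `1/16`; so there
are exponentially many of them (`exp_le_card_of_recover`), and `h * v` is of order at least
`p ^ 2` (`Scheme.card_le_of_index`).
-/

/-! ### Triangles of a multigraph under edge updates -/

section Triangles

open Finset

variable {n : ℕ}

theorem edgeMultiplicity_append (σ τ : List (EdgeUpdate n)) (a b : Fin n) :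
    edgeMultiplicity (σ ++ τ) a b = edgeMultiplicity σ a b + edgeMultiplicity τ a b := by
  simp [edgeMultiplicity]

theorem edgeMultiplicity_singleton (e : EdgeUpdate n) (a b : Fin n) :
    edgeMultiplicity [e] a b = if s(e.fst, e.snd) = s(a, b) then e.amount else 0 := by
  simp [edgeMultiplicity]

theorem edgeMultiplicity_comm (σ : List (EdgeUpdate n)) (a b : Fin n) :
    edgeMultiplicity σ a b = edgeMultiplicity σ b a := by
  simp only [edgeMultiplicity, Sym2.eq_swap (a := a)]

theorem edgeMultiplicity_self (σ : List (EdgeUpdate n)) (a : Fin n) :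
    edgeMultiplicity σ a a = 0 := by
  induction σ with
  | nil => simp [edgeMultiplicity]
  | cons e σ ih =>
    rw [← List.singleton_append, edgeMultiplicity_append, ih, edgeMultiplicity_singleton, if_neg]
    · rfl
    · intro h
      rcases Sym2.eq_iff.1 h with h | h <;> exact e.ne (h.1.trans h.2.symm)

/-- A symmetric function that vanishes on triples with a repetition sums over all triples to six
times its sum over increasing triples. -/
theorem sum_eq_six_mul_sum_increasing {α : Type*} [Fintype α] [LinearOrder α]
    (F : α → α → α → ℤ) (h₁ : ∀ x y z, F x y z = F y x z) (h₂ : ∀ x y z, F x y z = F x z y)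
    (h₀ : ∀ x z, F x x z = 0) :
    ∑ x, ∑ y, ∑ z, F x y z =
      6 * ∑ x, ∑ y, ∑ z, if x < y ∧ y < z then F x y z else 0 := by
  set g : α → α → α → ℤ := fun x y z => if x < y ∧ y < z then F x y z else 0 with hg
  have key : ∀ x y z, F x y z = g x y z + g x z y + g y x z + g y z x + g z x y + g z y x := by
    intro x y z
    have e₀ : F x z z = 0 := by rw [h₁, h₂, h₀]
    have e₁ : F x z y = F x y z := (h₂ _ _ _).symm
    have e₂ : F y x z = F x y z := (h₁ _ _ _).symm
    have e₃ : F y z x = F x y z := by rw [← h₂, e₂]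
    have e₄ : F z x y = F x y z := by rw [h₁, e₁]
    have e₅ : F z y x = F x y z := by rw [h₁, e₃]
    simp only [hg, e₁, e₂, e₃, e₄, e₅]
    rcases eq_or_ne x y with rfl | hxy
    · simp [h₀]
    rcases eq_or_ne y z with rfl | hyz
    · simp [e₀]
    rcases eq_or_ne x z with rfl | hxz
    · simp [← e₁, h₀]
    clear_value g
    clear e₀ e₁ e₂ e₃ e₄ e₅ h₀ h₁ h₂ hg
    rcases hxy.lt_or_gt with a | a <;> rcases hyz.lt_or_gt with b | b <;>
      rcases hxz.lt_or_gt with c | c <;>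
      first
      | exact absurd (a.trans b) c.not_gt
      | exact absurd (b.trans a) c.not_gt
      | simp [a, b, c, a.not_gt, b.not_gt, c.not_gt]
  have r₁ : ∀ f : α → α → α → ℤ, ∑ x, ∑ y, ∑ z, f y x z = ∑ x, ∑ y, ∑ z, f x y z :=
    fun f => sum_comm
  have r₂ : ∀ f : α → α → α → ℤ, ∑ x, ∑ y, ∑ z, f x z y = ∑ x, ∑ y, ∑ z, f x y z :=
    fun f => sum_congr rfl fun _ _ => sum_comm
  have s₁ := r₂ g
  have s₂ := r₁ g
  have s₃ := (r₁ fun x y z => g x z y).trans (r₂ g)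
  have s₄ := (r₂ fun x y z => g y x z).trans (r₁ g)
  have s₅ := (r₁ fun x y z => g z x y).trans s₄
  have hF : ∑ x, ∑ y, ∑ z, F x y z = ∑ x, ∑ y, ∑ z,
      (g x y z + g x z y + g y x z + g y z x + g z x y + g z y x) :=
    sum_congr rfl fun x _ => sum_congr rfl fun y _ => sum_congr rfl fun z _ => key x y z
  simp only [sum_add_distrib, s₁, s₂, s₃, s₄, s₅] at hF
  rw [hF]
  ring

theorem six_mul_triangleCount (σ : List (EdgeUpdate n)) :
    6 * triangleCount σ = ∑ x, ∑ y, ∑ z,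
      edgeMultiplicity σ x y * edgeMultiplicity σ y z * edgeMultiplicity σ x z := by
  rw [triangleCount, sum_eq_six_mul_sum_increasing
    (fun x y z => edgeMultiplicity σ x y * edgeMultiplicity σ y z * edgeMultiplicity σ x z)]
  · intro x y z
    rw [edgeMultiplicity_comm σ x y]; ring
  · intro x y z
    rw [edgeMultiplicity_comm σ y z]; ring
  · intro x z
    simp [edgeMultiplicity_self]

/-- A token changes the number of triangles by its amount times the number of paths of length two
that join the ends of its edge. -/
theorem triangleCount_concat (σ : List (EdgeUpdate n)) (e : EdgeUpdate n) :
    triangleCount (σ ++ [e]) = triangleCount σ +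
      e.amount * ∑ w, edgeMultiplicity σ e.fst w * edgeMultiplicity σ e.snd w := by
  obtain ⟨u, v, huv, d⟩ := e
  set A := edgeMultiplicity σ with hA
  have hs : ∀ x y, A x y = A y x := edgeMultiplicity_comm σ
  have h0 : ∀ x, A x x = 0 := edgeMultiplicity_self σ
  set E : Fin n → Fin n → ℤ := fun x y => if s(u, v) = s(x, y) then 1 else 0 with hE
  have hEs : ∀ x y, E x y = E y x := fun x y => by simp only [hE, Sym2.eq_swap (a := x)]
  have hA' : ∀ x y, edgeMultiplicity (σ ++ [⟨u, v, huv, d⟩]) x y = A x y + d * E x y := by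
    intro x y
    simp [edgeMultiplicity_append, edgeMultiplicity_singleton, hE, hA]
  have hE0 : ∀ x y z, E x y * E y z * A x z = 0 := by
    intro x y z
    simp only [hE]
    split_ifs with a b
    · have : x = z := by
        have := a.symm.trans b
        simp only [Sym2.eq_iff] at this
        grind
      simp [this, h0]
    all_goals simp
  have hE3 : ∀ x y z, E x y * E y z * E x z = 0 := by
    intro x y z
    simp only [hE, Sym2.eq_iff]
    split_ifs <;> grind
  set c : Fin n → Fin n → Fin n → ℤ := fun x y z => E x y * (A x z * A y z) with hc
  have hsum : ∑ x, ∑ y, ∑ z, c x y z = 2 * ∑ w, A u w * A v w := by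
    have hE' : ∀ x y, E x y = (if u = x then if v = y then 1 else 0 else 0) +
        if v = x then if u = y then 1 else 0 else 0 := by
      intro x y
      simp only [hE, Sym2.eq_iff]
      split_ifs <;> grind
    simp only [hc, hE', add_mul, sum_add_distrib, ite_mul, one_mul, zero_mul]
    simp only [sum_ite_irrel, sum_const_zero, sum_ite_eq, mem_univ, if_true]
    simp only [mul_comm (A v _)]
    ring
  have r₁ : ∀ f : Fin n → Fin n → Fin n → ℤ, ∑ x, ∑ y, ∑ z, f y x z = ∑ x, ∑ y, ∑ z, f x y z :=
    fun f => sum_comm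
  have r₂ : ∀ f : Fin n → Fin n → Fin n → ℤ, ∑ x, ∑ y, ∑ z, f x z y = ∑ x, ∑ y, ∑ z, f x y z :=
    fun f => sum_congr rfl fun _ _ => sum_comm
  have s₁ := r₂ c
  have s₂ := (r₁ fun x y z => c x z y).trans (r₂ c)
  have key : ∀ x y z, (A x y + d * E x y) * (A y z + d * E y z) * (A x z + d * E x z) =
      A x y * A y z * A x z + d * (c x y z + c y z x + c x z y) := by
    intro x y z
    have e₁ := hE0 x y z
    have e₂ := hE0 y x z
    have e₃ := hE0 x z y
    have e₄ := hE3 x y z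
    rw [hEs y x] at e₂
    rw [hEs z y] at e₃
    simp only [hc]
    rw [hs z y, hs z x, hs y x] at *
    linear_combination d ^ 2 * e₁ + d ^ 2 * e₂ + d ^ 2 * e₃ + d ^ 3 * e₄
  have t₁ := six_mul_triangleCount (σ ++ [⟨u, v, huv, d⟩])
  have t₂ := six_mul_triangleCount σ
  simp only [hA', key, sum_add_distrib, ← mul_sum] at t₁
  rw [← hA] at t₂
  rw [s₁, s₂, hsum, ← t₂] at t₁
  simp only
  linarith

theorem triangleCount_nil : triangleCount ([] : List (EdgeUpdate n)) = 0 := by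
  simp [triangleCount, edgeMultiplicity]

theorem triangleCount_nonneg {M : ℕ} {σ : List (EdgeUpdate n)} (hσ : σ ∈ multigraphStreams n M) :
    0 ≤ triangleCount σ := by
  refine sum_nonneg fun x _ => sum_nonneg fun y _ => sum_nonneg fun z _ => ?_
  split_ifs
  · exact mul_nonneg (mul_nonneg (hσ x y).1 (hσ y z).1) (hσ x z).1
  · exact le_rfl

theorem triangleCount_le {M : ℕ} {σ : List (EdgeUpdate n)} (hσ : σ ∈ multigraphStreams n M) :
    triangleCount σ ≤ (n : ℤ) ^ 3 * (M : ℤ) ^ 3 := by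
  have hb : ∀ x y z : Fin n, (if x < y ∧ y < z then
      edgeMultiplicity σ x y * edgeMultiplicity σ y z * edgeMultiplicity σ x z else 0) ≤
        (M : ℤ) ^ 3 := by
    intro x y z
    split_ifs
    · calc _ ≤ (M : ℤ) * M * M :=
            mul_le_mul (mul_le_mul (hσ x y).2 (hσ y z).2 (hσ y z).1 (by positivity)) (hσ x z).2
              (hσ x z).1 (by positivity)
        _ = _ := by ring
    · positivity
  calc triangleCount σ ≤ ∑ _x : Fin n, ∑ _y : Fin n, ∑ _z : Fin n, (M : ℤ) ^ 3 :=
        sum_le_sum fun x _ => sum_le_sum fun y _ => sum_le_sum fun z _ => hb x y z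
    _ = _ := by simp; ring

end Triangles

/-! ### Schemes with an arbitrary finite set of memory states -/

namespace Scheme

section OfStates

variable {Token Out St : Type}

/-- The scheme whose memory states are the elements of `St`, stored as strings of `b` bits through
`enc` and read back through `dec`. -/
def ofStates (N : ℕ) (hN : 0 < N) (b : ℕ) (enc : St → (Fin b → Bool)) (dec : (Fin b → Bool) → St)
    (init : St) (tok : Fin N → St → Token → St) (help : Fin N → St → Bool → St)
    (out : St → Option Out) : Scheme Token Out where
  coins := N
  coins_pos := hN
  space := b
  start _ := enc init
  onToken R c e := enc (tok R (dec c) e)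
  onHelpBit R c e := enc (help R (dec c) e)
  output _ c := out (dec c)

theorem result_ofStates {N : ℕ} {hN : 0 < N} {b : ℕ} {enc : St → (Fin b → Bool)}
    {dec : (Fin b → Bool) → St} (h : Function.LeftInverse dec enc) (init : St)
    (tok : Fin N → St → Token → St) (help : Fin N → St → Bool → St) (out : St → Option Out)
    (R : Fin N) (σ : List Token) (m : List Bool) :
    (ofStates N hN b enc dec init tok help out).result R σ m =
      out (m.foldl (help R) (σ.foldl (tok R) init)) := by
  simp only [result, summary, ofStates]
  rw [List.foldl_hom enc (g₁ := tok R) (H := fun x y => by rw [h x]),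
    List.foldl_hom enc (g₁ := help R) (H := fun x y => by rw [h x]), h]

end OfStates

end Scheme

/-! ### Sending a polynomial bit by bit -/

section Messages

open Polynomial Finset

/-- The sum of the polynomials `w i` over the positions `i ≥ pos` at which the message, read from
position `pos` on, has a bit `true`. -/
noncomputable def messagePoly {K : Type*} [Semiring K] (w : ℕ → K[X]) : ℕ → List Bool → K[X]
  | _, [] => 0
  | pos, b :: m => (if b then w pos else 0) + messagePoly w (pos + 1) m

theorem messagePoly_ofFn {K : Type*} [Semiring K] (w : ℕ → K[X]) {l : ℕ} (f : Fin l → Bool)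
    (pos : ℕ) :
    messagePoly w pos (List.ofFn f) = ∑ i : Fin l, if f i then w (pos + i) else 0 := by
  induction l generalizing pos with
  | zero => simp [messagePoly]
  | succ l ih =>
    rw [List.ofFn_succ, messagePoly, ih, Fin.sum_univ_succ]
    simp only [Fin.val_zero, Fin.val_succ, add_zero, add_assoc, add_comm 1]

theorem messagePoly_mem {K : Type*} [Semiring K] {w : ℕ → K[X]} {V : Submodule K K[X]}
    (hw : ∀ i, w i ∈ V) (pos : ℕ) (m : List Bool) : messagePoly w pos m ∈ V := by
  induction m generalizing pos with
  | nil => exact V.zero_mem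
  | cons b m ih =>
    refine V.add_mem ?_ (ih _)
    split_ifs
    · exact hw _
    · exact V.zero_mem

/-- What a bit `true` at position `i` of a message contributes, when the message lists the
coefficients in blocks of `β` bits, the lowest coefficient and the lowest bit first, and everything
from position `L` on is ignored. -/
noncomputable def bitWeight (K : Type*) [Semiring K] (β L i : ℕ) : K[X] :=
  if i < L then monomial (i / β) (2 ^ (i % β)) else 0

theorem bitWeight_min (K : Type*) [Semiring K] (β L i : ℕ) :
    bitWeight K β L (min i L) = bitWeight K β L i := by
  rcases le_total i L with h | h
  · rw [min_eq_left h]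
  · simp [bitWeight, h]

theorem bitWeight_mem_degreeLT (K : Type*) [Semiring K] (β D i : ℕ) :
    bitWeight K β (D * β) i ∈ degreeLT K D := by
  unfold bitWeight
  split_ifs with h
  · refine mem_degreeLT.2 ((degree_monomial_le _ _).trans_lt ?_)
    exact_mod_cast Nat.div_lt_of_lt_mul (by rwa [mul_comm] at h)
  · exact Submodule.zero_mem _

theorem exists_bits (β c : ℕ) (hc : c < 2 ^ β) :
    ∃ g : Fin β → Bool, ∑ l, (if g l then 2 ^ (l : ℕ) else 0) = c := by
  induction β generalizing c with
  | zero => exact ⟨fun _ => false, by simp at hc; simp [hc]⟩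
  | succ β ih =>
    obtain ⟨g, hg⟩ := ih (c / 2) (by rw [pow_succ] at hc; omega)
    refine ⟨Fin.cons (decide (c % 2 = 1)) g, ?_⟩
    have h2 : ∑ l, (if g l then 2 ^ ((l : ℕ) + 1) else 0) = 2 * (c / 2) := by
      rw [← hg, mul_sum]
      exact sum_congr rfl fun l _ => by split_ifs <;> simp [pow_succ, mul_comm]
    rw [Fin.sum_univ_succ]
    simp only [Fin.cons_zero, Fin.cons_succ, Fin.val_zero, Fin.val_succ, h2]
    split_ifs with h <;> simp at h ⊢ <;> omega

/-- Over `ZMod q`, where `q ≤ 2 ^ β`, every polynomial of degree less than `D` is sent by some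
message of `D * β` bits. -/
theorem exists_messagePoly_eq {q β D : ℕ} [NeZero q] (hq : q ≤ 2 ^ β) {P : (ZMod q)[X]}
    (hP : P ∈ degreeLT (ZMod q) D) :
    ∃ m : List Bool, m.length = D * β ∧
      messagePoly (bitWeight (ZMod q) β (D * β)) 0 m = P := by
  choose g hg using fun k : Fin D =>
    exists_bits β (P.coeff k).val ((ZMod.val_lt (P.coeff k)).trans_le hq)
  refine ⟨List.ofFn fun i : Fin (D * β) => g i.divNat i.modNat, by simp, ?_⟩
  rw [messagePoly_ofFn, ← Equiv.sum_comp finProdFinEquiv, Fintype.sum_prod_type]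
  have hP' : P = ∑ k : Fin D, monomial (k : ℕ) (P.coeff k) := by
    rw [Fin.sum_univ_eq_sum_range (fun k => monomial k (P.coeff k))]
    rcases eq_or_ne P 0 with h0 | h0
    · simp [h0]
    · exact P.as_sum_range' D ((natDegree_lt_iff_degree_lt h0).2 (mem_degreeLT.1 hP))
  conv_rhs => rw [hP']
  refine sum_congr rfl fun k _ => ?_
  have hk : P.coeff k = ∑ l : Fin β, if g k l then (2 : ZMod q) ^ (l : ℕ) else 0 := by
    rw [← ZMod.natCast_zmod_val (P.coeff k), ← hg k]
    push_cast
    rfl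
  rw [hk, map_sum]
  refine sum_congr rfl fun l _ => ?_
  have hkl := finProdFinEquiv.symm_apply_apply (k, l)
  simp only [finProdFinEquiv_symm_apply, Prod.mk.injEq] at hkl
  rw [hkl.1, hkl.2]
  have hd := congrArg Fin.val hkl.1
  have hm := congrArg Fin.val hkl.2
  simp only [Fin.coe_divNat, Fin.coe_modNat] at hd hm
  split_ifs
  · rw [zero_add, bitWeight, if_pos (finProdFinEquiv (k, l)).2, hd, hm]
  · simp

end Messages

/-! ### The nonlinear sketch and the laconic scheme -/

namespace LaconicTriangle

open Polynomial Finset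

variable {n t s q : ℕ} [Fact q.Prime]

/-- The polynomial of degree `t - 1` that is `1` at `i` and `0` at the other points of
`{0, …, t - 1}`. -/
noncomputable def delta (q : ℕ) [Fact q.Prime] {t : ℕ} (i : Fin t) : (ZMod q)[X] :=
  Lagrange.basis univ (fun k : Fin t => ((k : ℕ) : ZMod q)) i

theorem natCast_injective_fin (htq : t ≤ q) :
    Function.Injective fun k : Fin t => ((k : ℕ) : ZMod q) := by
  intro a b hab
  have h := (ZMod.natCast_eq_natCast_iff' _ _ _).1 hab
  rw [Nat.mod_eq_of_lt (a.2.trans_le htq), Nat.mod_eq_of_lt (b.2.trans_le htq)] at h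
  exact Fin.ext h

theorem eval_delta (htq : t ≤ q) (i k : Fin t) :
    (delta q i).eval ((k : ℕ) : ZMod q) = if i = k then 1 else 0 := by
  split_ifs with h
  · subst h
    exact Lagrange.eval_basis_self (natCast_injective_fin htq).injOn (mem_univ i)
  · exact Lagrange.eval_basis_of_ne (v := fun k : Fin t => ((k : ℕ) : ZMod q)) h (mem_univ k)

theorem natDegree_delta (htq : t ≤ q) (i : Fin t) : (delta q i).natDegree = t - 1 := by
  rw [delta, Lagrange.natDegree_basis (natCast_injective_fin htq).injOn (mem_univ i)]
  simp

/-- With the vertices laid out in a `t × s` grid by `φ`, the low-degree extension, in the direction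
of length `t`, of row `u` of the adjacency matrix at the end of the stream, restricted to column `j`
of the grid. -/
noncomputable def rowPoly (q : ℕ) [Fact q.Prime] (φ : Fin n → Fin t × Fin s)
    (σ : List (EdgeUpdate n)) (u : Fin n) (j : Fin s) : (ZMod q)[X] :=
  ∑ w, if (φ w).2 = j then C (edgeMultiplicity σ u w : ZMod q) * delta q (φ w).1 else 0

theorem rowPoly_concat (φ : Fin n → Fin t × Fin s) (σ : List (EdgeUpdate n)) (e : EdgeUpdate n)
    (u : Fin n) (j : Fin s) :
    rowPoly q φ (σ ++ [e]) u j = rowPoly q φ σ u j +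
      (if u = e.fst ∧ (φ e.snd).2 = j then C (e.amount : ZMod q) * delta q (φ e.snd).1 else 0) +
      (if u = e.snd ∧ (φ e.fst).2 = j then C (e.amount : ZMod q) * delta q (φ e.fst).1 else 0) := by
  have h : ∀ w, (if (φ w).2 = j then
      C (edgeMultiplicity (σ ++ [e]) u w : ZMod q) * delta q (φ w).1 else 0) =
      (if (φ w).2 = j then C (edgeMultiplicity σ u w : ZMod q) * delta q (φ w).1 else 0) +
      (if e.snd = w then (if u = e.fst ∧ (φ w).2 = j then
        C (e.amount : ZMod q) * delta q (φ w).1 else 0) else 0) +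
      (if e.fst = w then (if u = e.snd ∧ (φ w).2 = j then
        C (e.amount : ZMod q) * delta q (φ w).1 else 0) else 0) := by
    intro w
    have hne := e.ne
    rw [edgeMultiplicity_append, edgeMultiplicity_singleton]
    by_cases hj : (φ w).2 = j
    · by_cases h₁ : e.fst = u ∧ e.snd = w
      · obtain ⟨rfl, rfl⟩ := h₁
        simp [hj, hne, add_mul]
      · by_cases h₂ : e.fst = w ∧ e.snd = u
        · obtain ⟨rfl, rfl⟩ := h₂
          simp [hj, hne.symm, add_mul]
        · have h₃ : ¬ s(e.fst, e.snd) = s(u, w) := by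
            rw [Sym2.eq_iff]; tauto
          rw [if_neg h₃]
          have h₄ : ¬ (e.snd = w ∧ u = e.fst) := fun h => h₁ ⟨h.2.symm, h.1⟩
          have h₅ : ¬ (e.fst = w ∧ u = e.snd) := fun h => h₂ ⟨h.1, h.2.symm⟩
          simp only [hj, and_true, ← ite_and, h₄, h₅]
          simp
    · simp [hj]
  simp only [rowPoly, h, sum_add_distrib, sum_ite_eq, mem_univ, if_true]

theorem natDegree_rowPoly_le (htq : t ≤ q) (φ : Fin n → Fin t × Fin s) (σ : List (EdgeUpdate n))
    (u : Fin n) (j : Fin s) : (rowPoly q φ σ u j).natDegree ≤ t - 1 := by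
  refine natDegree_sum_le_of_forall_le _ _ fun w _ => ?_
  split_ifs
  · exact (natDegree_C_mul_le _ _).trans (natDegree_delta htq _).le
  · simp

theorem eval_rowPoly (htq : t ≤ q) (φ : Fin n → Fin t × Fin s) (σ : List (EdgeUpdate n))
    (u : Fin n) (i : Fin t) (j : Fin s) :
    (rowPoly q φ σ u j).eval ((i : ℕ) : ZMod q) =
      ∑ w, if φ w = (i, j) then (edgeMultiplicity σ u w : ZMod q) else 0 := by
  rw [rowPoly, eval_finsetSum]
  refine sum_congr rfl fun w _ => ?_
  rw [apply_ite (eval _), eval_mul, eval_C, eval_delta htq, eval_zero]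
  simp only [Prod.ext_iff]
  split_ifs <;> simp_all

/-- Spreading two functions along the same injection does not change their inner product. -/
theorem sum_fiber_mul_fiber {ι κ R : Type*} [Fintype ι] [Fintype κ] [DecidableEq κ] [CommRing R]
    {φ : ι → κ} (hφ : Function.Injective φ) (f g : ι → R) :
    ∑ k, (∑ w, if φ w = k then f w else 0) * (∑ w, if φ w = k then g w else 0) =
      ∑ w, f w * g w := by
  classical
  simp only [sum_mul, ite_mul, zero_mul]
  rw [sum_comm]
  simp [hφ.eq_iff]

theorem sum_eval_rowPoly_mul (htq : t ≤ q) {φ : Fin n → Fin t × Fin s}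
    (hφ : Function.Injective φ) (σ : List (EdgeUpdate n)) (u v : Fin n) :
    ∑ i : Fin t, (∑ j, rowPoly q φ σ u j * rowPoly q φ σ v j).eval ((i : ℕ) : ZMod q) =
      ((∑ w, edgeMultiplicity σ u w * edgeMultiplicity σ v w : ℤ) : ZMod q) := by
  simp only [eval_finsetSum, eval_mul, eval_rowPoly htq]
  rw [← Fintype.sum_prod_type' (f := fun i j => (∑ w, if φ w = (i, j) then
    (edgeMultiplicity σ u w : ZMod q) else 0) * ∑ w, if φ w = (i, j) then
    (edgeMultiplicity σ v w : ZMod q) else 0)]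
  simp only [Prod.mk.eta]
  rw [sum_fiber_mul_fiber hφ]
  push_cast
  rfl

/-- Verifier's memory: the values at his secret point `r` of the polynomials `rowPoly`; the value at
`r` of the polynomial that Prover should send, from which what is read of the message is subtracted;
the sum over `{0, …, t - 1}` of the values of the message read; and the position in the message. -/
abbrev Memory (n s q L : ℕ) : Type :=
  (Fin n → Fin s → ZMod q) × ZMod q × ZMod q × Fin (L + 1)

/-- The memory of a Verifier who has read nothing. -/
def initial (n s q L : ℕ) : Memory n s q L := (0, 0, 0, 0)

/-- A token adds to the second component the triangles that its edge closes in the current state of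
the graph, extended to the point `r`; this makes the sketch depend on the order of the tokens. -/
noncomputable def readToken {L : ℕ} (φ : Fin n → Fin t × Fin s) (r : ZMod q)
    (c : Memory n s q L) (e : EdgeUpdate n) : Memory n s q L :=
  (fun u j => c.1 u j +
      (if u = e.fst ∧ (φ e.snd).2 = j then e.amount * (delta q (φ e.snd).1).eval r else 0) +
      (if u = e.snd ∧ (φ e.fst).2 = j then e.amount * (delta q (φ e.fst).1).eval r else 0),
    c.2.1 + e.amount * ∑ j, c.1 e.fst j * c.1 e.snd j, c.2.2)

/-- Verifier subtracts the contribution of the next bit from the value at `r`, and adds its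
contribution to the sum over `{0, …, t - 1}`. The position stops at `L`, where bits have weight
zero, so that a longer message still encodes a polynomial of the right degree. -/
noncomputable def readHelp (t β : ℕ) {L : ℕ} (r : ZMod q) (c : Memory n s q L) (b : Bool) :
    Memory n s q L :=
  (c.1, c.2.1 - (if b then bitWeight (ZMod q) β L c.2.2.2 else 0).eval r,
    c.2.2.1 + ∑ i : Fin t,
      (if b then bitWeight (ZMod q) β L c.2.2.2 else 0).eval ((i : ℕ) : ZMod q),
    ⟨min (c.2.2.2 + 1) L, by omega⟩)

/-- Verifier accepts if the message agrees at `r` with the polynomial computed from the stream. -/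
def answer {L : ℕ} (c : Memory n s q L) : Option ℤ :=
  if c.2.1 = 0 then some (c.2.2.1.val : ℤ) else none

/-- After a stream, the second component of Verifier's memory is the value at `r` of a polynomial of
degree at most `2 * (t - 1)`, independent of `r`, whose values at `0, …, t - 1` add up to the number
of triangles. -/
theorem exists_streamPoly (ht : 0 < t) (htq : t ≤ q) {φ : Fin n → Fin t × Fin s}
    (hφ : Function.Injective φ) (L : ℕ) (σ : List (EdgeUpdate n)) :
    ∃ P ∈ degreeLT (ZMod q) (2 * t - 1),
      ∑ i : Fin t, P.eval ((i : ℕ) : ZMod q) = (triangleCount σ : ZMod q) ∧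
      ∀ r, σ.foldl (readToken φ r) (initial n s q L) =
        (fun u j => (rowPoly q φ σ u j).eval r, P.eval r, 0, 0) := by
  induction σ using List.reverseRecOn with
  | nil =>
    refine ⟨0, Submodule.zero_mem _, by simp [triangleCount_nil], fun r => ?_⟩
    simp [initial, rowPoly, edgeMultiplicity]
    rfl
  | append_singleton σ e ih =>
    obtain ⟨P, hP, hsum, hfold⟩ := ih
    refine ⟨P + C (e.amount : ZMod q) * ∑ j, rowPoly q φ σ e.fst j * rowPoly q φ σ e.snd j,
      Submodule.add_mem _ hP ?_, ?_, fun r => ?_⟩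
    · rw [← smul_eq_C_mul]
      refine Submodule.smul_mem _ _ (Submodule.sum_mem _ fun j _ => mem_degreeLT.2 ?_)
      refine degree_le_natDegree.trans_lt ?_
      have h₁ := natDegree_rowPoly_le htq φ σ e.fst j
      have h₂ := natDegree_rowPoly_le htq φ σ e.snd j
      have h₃ := natDegree_mul_le (p := rowPoly q φ σ e.fst j) (q := rowPoly q φ σ e.snd j)
      exact_mod_cast (by omega : _ < 2 * t - 1)
    · simp only [eval_add, eval_mul, eval_C, sum_add_distrib, ← mul_sum]
      rw [hsum, sum_eval_rowPoly_mul htq hφ, triangleCount_concat]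
      push_cast
      rfl
    · rw [List.foldl_append, hfold]
      simp only [List.foldl_cons, List.foldl_nil, readToken, rowPoly_concat, eval_add, eval_mul,
        eval_C, eval_finsetSum, apply_ite (eval r), eval_zero]

theorem foldl_readHelp (β : ℕ) {L : ℕ} (r : ZMod q) (m : List Bool) (f : Fin n → Fin s → ZMod q)
    (d a : ZMod q) (pos : ℕ) : ∃ p,
    m.foldl (readHelp t β r) (f, d, a, (⟨min pos L, by omega⟩ : Fin (L + 1))) =
      (f, d - (messagePoly (bitWeight (ZMod q) β L) pos m).eval r,
        a + ∑ i : Fin t, (messagePoly (bitWeight (ZMod q) β L) pos m).eval ((i : ℕ) : ZMod q),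
        p) := by
  induction m generalizing d a pos with
  | nil => exact ⟨_, by simp [messagePoly]; rfl⟩
  | cons b m ih =>
    have hpos : min (min pos L + 1) L = min (pos + 1) L := by omega
    simp only [List.foldl_cons, readHelp, bitWeight_min, hpos, messagePoly, eval_add,
      sum_add_distrib]
    obtain ⟨p, hp⟩ := ih (d - (if b then bitWeight (ZMod q) β L pos else 0).eval r)
      (a + ∑ i : Fin t, (if b then bitWeight (ZMod q) β L pos else 0).eval ((i : ℕ) : ZMod q))
      (pos + 1)
    exact ⟨p, by rw [hp]; simp only [sub_sub, add_assoc]⟩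

theorem exists_scheme_of_prime {n t s q β b M : ℕ} (hq : q.Prime) (ht : 0 < t) (hts : n ≤ t * s)
    (htq : 6 * t ≤ q) (hMq : n ^ 3 * M ^ 3 < q) (hqβ : q ≤ 2 ^ β)
    (hb : q ^ (n * s) * (q * (q * ((2 * t - 1) * β + 1))) ≤ 2 ^ b) :
    ∃ S : Scheme (EdgeUpdate n) ℤ, S.space = b ∧ S.coins = q ∧
      S.IsComplete (multigraphStreams n M) triangleCount ((2 * t - 1) * β) 0 ∧
      S.IsSound (multigraphStreams n M) triangleCount (1 / 3) := by
  have : Fact q.Prime := ⟨hq⟩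
  obtain ⟨φ⟩ : Nonempty (Fin n ↪ Fin t × Fin s) :=
    Function.Embedding.nonempty_of_card_le (by simpa using hts)
  have hφ := φ.injective
  set L := (2 * t - 1) * β with hL
  obtain ⟨enc⟩ : Nonempty (Memory n s q L ↪ (Fin b → Bool)) := by
    refine Function.Embedding.nonempty_of_card_le ?_
    simp only [Fintype.card_prod, Fintype.card_pi, prod_const, ZMod.card, Fintype.card_fin,
      Fintype.card_bool, card_univ, ← pow_mul]
    rwa [mul_comm s n]
  have : Nonempty (Memory n s q L) := ⟨initial n s q L⟩
  set S : Scheme (EdgeUpdate n) ℤ := Scheme.ofStates q hq.pos b enc (Function.invFun enc)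
    (initial n s q L) (fun R => readToken φ ((R : ℕ) : ZMod q))
    (fun R => readHelp t β ((R : ℕ) : ZMod q)) answer with hS
  have hdec : Function.LeftInverse (Function.invFun enc) enc :=
    Function.leftInverse_invFun enc.injective
  have hcoins : S.coins = q := rfl
  have htq' : t ≤ q := by omega
  -- an accepted message gives the sum of the values of the polynomial it encodes
  have hres : ∀ σ, ∃ P ∈ degreeLT (ZMod q) (2 * t - 1),
      ∑ i : Fin t, P.eval ((i : ℕ) : ZMod q) = (triangleCount σ : ZMod q) ∧
      ∀ (R : Fin S.coins) (m : List Bool), S.result R σ m =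
        if P.eval ((R : ℕ) : ZMod q) -
            (messagePoly (bitWeight (ZMod q) β L) 0 m).eval ((R : ℕ) : ZMod q) = 0 then
          some ((∑ i : Fin t, (messagePoly (bitWeight (ZMod q) β L) 0 m).eval
            ((i : ℕ) : ZMod q)).val : ℤ) else none := by
    intro σ
    obtain ⟨P, hP, hsum, hfold⟩ := exists_streamPoly ht htq' hφ L σ
    refine ⟨P, hP, hsum, fun R m => ?_⟩
    obtain ⟨p, hp⟩ := foldl_readHelp (t := t) β (L := L) ((R : ℕ) : ZMod q) m
      (fun u j => (rowPoly q φ σ u j).eval ((R : ℕ) : ZMod q)) (P.eval ((R : ℕ) : ZMod q)) 0 0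
    have h0 : (⟨min 0 L, by omega⟩ : Fin (L + 1)) = 0 := by ext; simp
    rw [h0] at hp
    refine (Scheme.result_ofStates hdec _ _ _ _ R σ m).trans ?_
    rw [hfold, hp]
    simp [answer]
  have hval : ∀ σ ∈ multigraphStreams n M,
      (((triangleCount σ : ℤ) : ZMod q).val : ℤ) = triangleCount σ := by
    intro σ hσ
    rw [ZMod.val_intCast]
    refine Int.emod_eq_of_lt (triangleCount_nonneg hσ) ((triangleCount_le hσ).trans_lt ?_)
    exact_mod_cast hMq
  refine ⟨S, rfl, rfl, fun σ hσ => ?_, fun σ hσ m => ?_⟩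
  · obtain ⟨P, hP, hsum, hr⟩ := hres σ
    obtain ⟨m, hm, hmP⟩ := exists_messagePoly_eq hqβ hP
    refine ⟨m, hm.le, ?_⟩
    have hall : ∀ R : Fin S.coins, S.result R σ m = some (triangleCount σ) := by
      intro R
      rw [hr R m, hmP, sub_self, if_pos rfl, hsum, hval σ hσ]
    have hne : (S.coins : ℝ) ≠ 0 := by exact_mod_cast S.coins_pos.ne'
    simp [Scheme.prob, hall, hne]
  · obtain ⟨P, hP, hsum, hr⟩ := hres σ
    set Q := messagePoly (bitWeight (ZMod q) β L) 0 m with hQ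
    have hQmem : Q ∈ degreeLT (ZMod q) (2 * t - 1) :=
      messagePoly_mem (fun i => bitWeight_mem_degreeLT _ _ _ i) 0 m
    rw [Scheme.prob, div_le_iff₀ (by exact_mod_cast S.coins_pos)]
    rcases eq_or_ne P Q with hPQ | hPQ
    · have hnone : ∀ R : Fin S.coins, ¬ (S.result R σ m ≠ some (triangleCount σ) ∧
          S.result R σ m ≠ none) := by
        rintro R ⟨h, -⟩
        apply h
        rw [hr R m, ← hQ, ← hPQ, sub_self, if_pos rfl, hsum, hval σ hσ]
      have : IsEmpty {R : Fin S.coins // S.result R σ m ≠ some (triangleCount σ) ∧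
          S.result R σ m ≠ none} := ⟨fun R => hnone R.1 R.2⟩
      rw [Nat.card_of_isEmpty]
      simp only [Nat.cast_zero]
      positivity
    · -- the two polynomials agree at no more points than their degree
      have hsub : P - Q ≠ 0 := sub_ne_zero.2 hPQ
      have hroots : Nat.card {R : Fin S.coins // S.result R σ m ≠ some (triangleCount σ) ∧
          S.result R σ m ≠ none} ≤ (P - Q).roots.toFinset.card := by
        have hroot : ∀ R : {R : Fin S.coins // S.result R σ m ≠ some (triangleCount σ) ∧
            S.result R σ m ≠ none}, ((R.1 : ℕ) : ZMod q) ∈ (P - Q).roots.toFinset := by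
          rintro ⟨R, -, h⟩
          rw [Multiset.mem_toFinset, mem_roots hsub, IsRoot.def, eval_sub]
          by_contra h0
          exact h (by rw [hr R m, if_neg h0])
        rw [← Nat.card_eq_finsetCard]
        refine Nat.card_le_card_of_injective (fun R => ⟨_, hroot R⟩) fun R R' h => Subtype.ext ?_
        exact natCast_injective_fin (le_refl q) (Subtype.mk.inj h)
      have hdeg : (P - Q).roots.toFinset.card ≤ 2 * t - 2 := by
        refine (Multiset.toFinset_card_le _).trans ((card_roots' _).trans ?_)
        have := (natDegree_lt_iff_degree_lt hsub).2
          (mem_degreeLT.1 (Submodule.sub_mem _ hP hQmem))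
        omega
      have : 3 * Nat.card {R : Fin S.coins // S.result R σ m ≠ some (triangleCount σ) ∧
          S.result R σ m ≠ none} ≤ q := by omega
      have h' : (3 : ℝ) * (Nat.card {R : Fin S.coins // S.result R σ m ≠ some (triangleCount σ) ∧
          S.result R σ m ≠ none} : ℝ) ≤ S.coins := by exact_mod_cast this
      linarith

theorem exists_scheme (C : ℕ) : ∃ K k : ℕ, ∀ n M t s : ℕ, 1 ≤ n → M ≤ n ^ C → 1 ≤ t → 1 ≤ s →
    n ≤ t * s → ∃ S : Scheme (EdgeUpdate n) ℤ,
      S.space ≤ K * (n * s) * (Nat.log 2 n + 1) ^ k ∧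
      S.coins ≤ 2 ^ (K * (n * s) * (Nat.log 2 n + 1) ^ k) ∧
      S.IsComplete (multigraphStreams n M) triangleCount (K * t * (Nat.log 2 n + 1) ^ k) 0 ∧
      S.IsSound (multigraphStreams n M) triangleCount (1 / 3) := by
  refine ⟨5 * (3 * C + 7), 1, fun n M t s hn hM ht hs hts => ?_⟩
  set l := Nat.log 2 n + 1 with hl
  have hnl : n < 2 ^ l := Nat.lt_pow_succ_log_self (by norm_num) n
  set β := (3 * C + 7) * l with hβ
  have hl1 : 1 ≤ l := by omega
  obtain ⟨q, hq, hq1, hq2⟩ := Nat.exists_prime_lt_and_le_two_mul (6 * n ^ (3 * C + 3))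
    (by positivity)
  have hnpow : n ≤ n ^ (3 * C + 3) := Nat.le_self_pow (by omega) n
  -- `β` bits hold an element of `ZMod q`
  have hqβ : q ≤ 2 ^ β := by
    calc q ≤ 2 ^ 4 * n ^ (3 * C + 3) := by omega
      _ ≤ 2 ^ (4 * l) * (2 ^ l) ^ (3 * C + 3) := by
          gcongr
          · norm_num
          · omega
      _ = 2 ^ β := by rw [← pow_mul, ← pow_add, hβ]; congr 1; ring
  -- more than `n` points in the direction of length `t` are never needed
  set t' := min t n with ht'
  have ht'1 : 0 < t' := by omega
  have hts' : n ≤ t' * s := by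
    rcases le_total t n with h | h
    · rwa [ht', min_eq_left h]
    · rw [ht', min_eq_right h]; exact Nat.le_mul_of_pos_right n hs
  have hns : 1 ≤ n * s := Nat.mul_pos hn hs
  have hMq : n ^ 3 * M ^ 3 < q := by
    calc n ^ 3 * M ^ 3 ≤ n ^ 3 * (n ^ C) ^ 3 := by gcongr
      _ = n ^ (3 * C + 3) := by rw [← pow_mul, ← pow_add]; congr 1; ring
      _ ≤ 6 * n ^ (3 * C + 3) := by omega
      _ < q := hq1
  have hL : (2 * t' - 1) * β + 1 ≤ 2 ^ (1 + l + β) := by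
    have h1 : β + 1 ≤ 2 ^ β := Nat.lt_two_pow_self
    have h2 : 2 * t' - 1 ≤ 2 * n - 1 := by omega
    calc (2 * t' - 1) * β + 1 ≤ (2 * n) * (β + 1) := by
          have := Nat.mul_le_mul_right β (h2.trans (Nat.sub_le _ _))
          nlinarith
      _ ≤ (2 * 2 ^ l) * 2 ^ β := by gcongr
      _ = _ := by ring
  have hb : q ^ (n * s) * (q * (q * ((2 * t' - 1) * β + 1))) ≤
      2 ^ (β * (n * s) + (β + (β + (1 + l + β)))) := by
    rw [pow_add _ (β * (n * s)), pow_add _ β, pow_add _ β, pow_mul 2 β]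
    exact Nat.mul_le_mul (Nat.pow_le_pow_left hqβ _) (Nat.mul_le_mul hqβ (Nat.mul_le_mul hqβ hL))
  obtain ⟨S, h1, h2, h3, h4⟩ := exists_scheme_of_prime hq ht'1 hts' (by omega) hMq hqβ hb
  have hβl : 1 + l ≤ β := by rw [hβ]; nlinarith
  have hβs : β ≤ β * (n * s) := Nat.le_mul_of_pos_right _ hns
  have hspace : β * (n * s) + (β + (β + (1 + l + β))) ≤ 5 * (3 * C + 7) * (n * s) * l ^ 1 := by
    calc _ ≤ 5 * (β * (n * s)) := by omega
      _ = _ := by rw [hβ]; ring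
  refine ⟨S, h1.le.trans hspace, ?_, ?_, h4⟩
  · rw [h2]
    exact hqβ.trans (Nat.pow_le_pow_right (by norm_num) ((by omega : β ≤ _).trans hspace))
  · intro σ hσ
    obtain ⟨m, hm, hm'⟩ := h3 σ hσ
    refine ⟨m, hm.trans ?_, hm'⟩
    calc (2 * t' - 1) * β ≤ (5 * t) * β := by gcongr; omega
      _ = _ := by rw [hβ]; ring

end LaconicTriangle

/-! ### Schemes for the index problem -/

section IndexBound

open Finset

/-- If `B` has probability at most `1/3`, then among `2 * l` independent trials `B` occurs at least
`l` times with probability at most `(8/9) ^ l`. -/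
theorem card_half_bad_mul_le {α : Type*} [Fintype α] (B : α → Prop) [DecidablePred B]
    (hB : 3 * #{a | B a} ≤ Fintype.card α) (l : ℕ) :
    #{f : Fin (2 * l) → α | l ≤ #{c | B (f c)}} * 9 ^ l ≤ 8 ^ l * Fintype.card α ^ (2 * l) := by
  -- Markov's inequality for `2` to the number of occurrences of `B`
  have h₁ : #{f : Fin (2 * l) → α | l ≤ #{c | B (f c)}} * 2 ^ l ≤
      (∑ a : α, if B a then 2 else 1) ^ (2 * l) := by
    rw [Fintype.sum_pow, ← smul_eq_mul]
    refine (card_nsmul_le_sum _ _ _ fun f hf => ?_).trans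
      (sum_le_sum_of_subset (filter_subset _ _))
    rw [prod_ite, prod_const, prod_const_one, mul_one]
    exact Nat.pow_le_pow_right (by norm_num) (mem_filter.1 hf).2
  have h₂ : ∑ a : α, (if B a then 2 else 1) = Fintype.card α + #{a | B a} := by
    have : ∀ a, (if B a then 2 else 1) = 1 + if B a then 1 else 0 := fun a => by split_ifs <;> rfl
    simp only [this, sum_add_distrib, sum_const, card_univ, smul_eq_mul, mul_one, sum_boole,
      Nat.cast_id]
  rw [h₂] at h₁
  have h₃ : 9 ^ l * (Fintype.card α + #{a | B a}) ^ (2 * l) ≤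
      16 ^ l * Fintype.card α ^ (2 * l) := by
    rw [pow_mul, pow_mul, ← mul_pow, ← mul_pow]
    exact Nat.pow_le_pow_left (by nlinarith) l
  have h16 : (16 : ℕ) ^ l = 2 ^ l * 8 ^ l := by rw [← mul_pow]; norm_num
  refine Nat.le_of_mul_le_mul_left (c := 2 ^ l) ?_ (pow_pos (by norm_num) l)
  calc 2 ^ l * (#{f : Fin (2 * l) → α | l ≤ #{c | B (f c)}} * 9 ^ l)
      = 9 ^ l * (#{f : Fin (2 * l) → α | l ≤ #{c | B (f c)}} * 2 ^ l) := by ring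
    _ ≤ 9 ^ l * (Fintype.card α + #{a | B a}) ^ (2 * l) := Nat.mul_le_mul_left _ h₁
    _ ≤ _ := h₃
    _ = _ := by rw [h16]; ring

/-- An encoding of bit strings from which a uniformly random bit of a uniformly random string is
recovered with error at most `1/16` has exponentially many code words. -/
theorem exp_le_card_of_recover {ι Mem : Type*} [Fintype ι] [DecidableEq ι] [Fintype Mem]
    (enc : (ι → Bool) → Mem) (dec : Mem → ι → Bool)
    (h : 16 * ∑ x : ι → Bool, #{i | dec (enc x) i ≠ x i} ≤
      2 ^ Fintype.card ι * Fintype.card ι) :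
    Real.exp (Fintype.card ι / 4) ≤ Fintype.card Mem := by
  set N := Fintype.card ι with hN
  -- the exponential moment of the distance, summed over all code words
  have h₁ : ∑ x : ι → Bool, Real.exp (-(#{i | dec (enc x) i ≠ x i} : ℝ)) ≤
      Fintype.card Mem * (1 + Real.exp (-1)) ^ N := by
    have hball : ∀ y : ι → Bool, ∑ x : ι → Bool, Real.exp (-(#{i | y i ≠ x i} : ℝ)) =
        (1 + Real.exp (-1)) ^ N := by
      intro y
      have h₁ : ∀ x : ι → Bool, Real.exp (-(#{i | y i ≠ x i} : ℝ)) =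
          ∏ i, if y i ≠ x i then Real.exp (-1) else 1 := by
        intro x
        rw [prod_ite, prod_const, prod_const_one, mul_one, ← Real.exp_nat_mul]
        congr 1
        ring
      have h₂ := prod_univ_sum (fun _ : ι => (univ : Finset Bool))
        (fun i b => if y i ≠ b then Real.exp (-1) else 1)
      rw [Fintype.piFinset_univ] at h₂
      simp only [h₁]
      rw [← h₂, hN, ← card_univ, ← prod_const]
      refine prod_congr rfl fun i _ => ?_
      cases y i <;> simp [add_comm]
    calc ∑ x : ι → Bool, Real.exp (-(#{i | dec (enc x) i ≠ x i} : ℝ))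
        ≤ ∑ x : ι → Bool, ∑ c : Mem, Real.exp (-(#{i | dec c i ≠ x i} : ℝ)) :=
          sum_le_sum fun x _ => single_le_sum
            (f := fun c => Real.exp (-(#{i | dec c i ≠ x i} : ℝ)))
            (fun c _ => (Real.exp_pos _).le) (mem_univ (enc x))
      _ = ∑ c : Mem, ∑ x : ι → Bool, Real.exp (-(#{i | dec c i ≠ x i} : ℝ)) := sum_comm
      _ = _ := by simp [hball]
  -- the tangent of the exponential function at the average distance bounds it from below
  have h₂ : Real.exp (-(N / 16 : ℝ)) * 2 ^ N ≤
      ∑ x : ι → Bool, Real.exp (-(#{i | dec (enc x) i ≠ x i} : ℝ)) := by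
    have hpt : ∀ x : ι → Bool,
        Real.exp (-(N / 16 : ℝ)) * (1 + N / 16 - (#{i | dec (enc x) i ≠ x i} : ℝ)) ≤
          Real.exp (-(#{i | dec (enc x) i ≠ x i} : ℝ)) := by
      intro x
      have := Real.add_one_le_exp ((N / 16 : ℝ) - (#{i | dec (enc x) i ≠ x i} : ℝ))
      calc _ ≤ Real.exp (-(N / 16 : ℝ)) *
            Real.exp ((N / 16 : ℝ) - (#{i | dec (enc x) i ≠ x i} : ℝ)) := by
            gcongr
            linarith
        _ = _ := by rw [← Real.exp_add]; congr 1; ring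
    refine le_trans ?_ (sum_le_sum fun x _ => hpt x)
    rw [← mul_sum, sum_sub_distrib]
    have hc : ∑ _x : ι → Bool, (1 + (N : ℝ) / 16) = 2 ^ N * (1 + N / 16) := by
      simp [hN, mul_add]
    rw [hc]
    have h' : (16 : ℝ) * ∑ x : ι → Bool, (#{i | dec (enc x) i ≠ x i} : ℝ) ≤ 2 ^ N * N := by
      exact_mod_cast h
    gcongr
    linarith
  -- `5 / 16` is the sum of the rate `1 / 16` of errors and the rate `1 / 4` that is claimed
  have hnum : (1 + Real.exp (-1)) ≤ 2 * Real.exp (-(5 / 16)) := by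
    have e₁ : Real.exp (-1) ≤ 0.37 := by
      have := Real.exp_neg_one_lt_d9; linarith
    have e₂ : (11 : ℝ) / 16 ≤ Real.exp (-(5 / 16)) := by
      have := Real.add_one_le_exp (-(5 / 16) : ℝ); linarith
    have e₃ : (1.37 : ℝ) ≤ 2 * (11 / 16) := by norm_num
    linarith
  have h₃ : (1 + Real.exp (-1)) ^ N * Real.exp (N / 4) ≤ Real.exp (-(N / 16 : ℝ)) * 2 ^ N := by
    calc _ ≤ (2 * Real.exp (-(5 / 16))) ^ N * Real.exp (N / 4) := by gcongr
      _ = Real.exp (N * (-(5 / 16)) + N / 4) * 2 ^ N := by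
          rw [mul_pow, ← Real.exp_nat_mul, Real.exp_add]; ring
      _ = _ := by congr 2; ring
  have h₄ := h₃.trans (h₂.trans h₁)
  rw [mul_comm] at h₄
  exact le_of_mul_le_mul_right h₄ (by positivity)

theorem exists_finset_messages (h : ℕ) :
    ∃ s : Finset (List Bool), (∀ m, m.length ≤ h → m ∈ s) ∧ #s ≤ 2 ^ (h + 1) := by
  refine ⟨(range (h + 1)).biUnion fun k => univ.image fun f : Fin k → Bool => List.ofFn f,
    fun m hm => ?_, ?_⟩
  · simp only [mem_biUnion, mem_range, mem_image, mem_univ, true_and]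
    exact ⟨m.length, by omega, m.get, List.ofFn_get m⟩
  · refine card_biUnion_le.trans ?_
    calc ∑ k ∈ range (h + 1), #(univ.image fun f : Fin k → Bool => List.ofFn f)
        ≤ ∑ k ∈ range (h + 1), 2 ^ k :=
          sum_le_sum fun k _ => card_image_le.trans (by simp)
      _ ≤ 2 ^ (h + 1) := (Nat.geomSum_lt (le_refl 2) (by simp)).le

namespace Scheme

variable {Token Out : Type}

theorem three_mul_card_le_of_prob_le {S : Scheme Token Out} {E : Fin S.coins → Prop}
    [DecidablePred E] (h : S.prob E ≤ 1 / 3) : 3 * #{R | E R} ≤ Fintype.card (Fin S.coins) := by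
  rw [prob, div_le_iff₀ (by exact_mod_cast S.coins_pos), Nat.card_eq_fintype_card,
    Fintype.card_subtype] at h
  have : (3 : ℝ) * (#{R | E R} : ℝ) ≤ S.coins := by linarith
  rw [Fintype.card_fin]
  exact_mod_cast this

theorem three_mul_card_not_le_of_le_prob {S : Scheme Token Out} {E : Fin S.coins → Prop}
    [DecidablePred E] (h : 1 - 1 / 3 ≤ S.prob E) :
    3 * #{R | ¬ E R} ≤ Fintype.card (Fin S.coins) := by
  rw [prob, le_div_iff₀ (by exact_mod_cast S.coins_pos), Nat.card_eq_fintype_card,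
    Fintype.card_subtype] at h
  have h₁ := card_filter_add_card_filter_not (s := (univ : Finset (Fin S.coins))) E
  rw [card_univ, Fintype.card_fin] at h₁
  have h₂ : (#{R | E R} : ℝ) + (#{R | ¬ E R} : ℝ) = S.coins := by exact_mod_cast h₁
  have : (3 : ℝ) * (#{R | ¬ E R} : ℝ) ≤ S.coins := by linarith
  rw [Fintype.card_fin]
  exact_mod_cast this

/-- If on streams that consist of an encoding of a bit string followed by an encoding of an index a
scheme computes the bit at this index, then the product of its costs is of the order of the length
of the string. -/
theorem card_le_of_index {ι : Type*} [Fintype ι] [DecidableEq ι] {S : Scheme Token ℤ}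
    {D : Set (List Token)} {f : List Token → ℤ} {h : ℕ} (hc : S.IsComplete D f h (1 / 3))
    (hs : S.IsSound D f (1 / 3)) (alice : (ι → Bool) → List Token) (bob : ι → List Token)
    (hD : ∀ x i, alice x ++ bob i ∈ D)
    (hf : ∀ x i, f (alice x ++ bob i) = if x i then 1 else 0) :
    Fintype.card ι ≤ 48 * (h + 5) * S.space := by
  classical
  set N := Fintype.card ι with hN
  obtain ⟨l, hl⟩ : ∃ l, l = 6 * (h + 5) := ⟨_, rfl⟩
  set T := Fin (2 * l) → Fin S.coins
  have hT : Fintype.card T = S.coins ^ (2 * l) := by simp [T]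
  obtain ⟨msgs, hmsgs, hmsgs_card⟩ := exists_finset_messages h
  -- a help message is convincing if more than half of the copies output `1` on it
  set dec : T → (Fin (2 * l) → (Fin S.space → Bool)) → ι → Bool := fun R c i =>
    decide (∃ m : List Bool, m.length ≤ h ∧ l < #{k | S.output (R k)
      (m.foldl (S.onHelpBit (R k)) ((bob i).foldl (S.onToken (R k)) (c k))) = some 1}) with hdec
  set enc : T → (ι → Bool) → (Fin (2 * l) → (Fin S.space → Bool)) :=
    fun R x k => S.summary (R k) (alice x) with henc
  have hres : ∀ (R : T) x i, dec R (enc R x) i = decide (∃ m : List Bool, m.length ≤ h ∧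
      l < #{k | S.result (R k) (alice x ++ bob i) m = some 1}) := by
    intro R x i
    simp only [hdec, henc, result, summary, List.foldl_append]
  -- `(8 / 9) ^ 6 < 1 / 2`, so the error is below `1 / 16` even after the union bound
  have h89 : 2 ^ (h + 5) * 8 ^ l ≤ 9 ^ l := by
    rw [hl, pow_mul 8, pow_mul 9, ← mul_pow]
    exact Nat.pow_le_pow_left (by norm_num) _
  have herr : ∀ x i, 16 * #{R : T | dec R (enc R x) i ≠ x i} ≤ Fintype.card T := by
    intro x i
    refine Nat.le_of_mul_le_mul_left (c := 9 ^ l) ?_ (pow_pos (by norm_num) l)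
    have hmain : #{R : T | dec R (enc R x) i ≠ x i} * 9 ^ l ≤
        2 ^ (h + 1) * (8 ^ l * Fintype.card (Fin S.coins) ^ (2 * l)) := by
      cases hx : x i
      · have hbad : ∀ m, 3 * #{R | S.result R (alice x ++ bob i) m = some 1} ≤
            Fintype.card (Fin S.coins) := by
          intro m
          refine le_trans ?_ (three_mul_card_le_of_prob_le (hs _ (hD x i) m))
          refine Nat.mul_le_mul_left _ (card_le_card (monotone_filter_right _ fun R _ hR => ?_))
          simp [hR, hf, hx]
        have hsub : #{R : T | dec R (enc R x) i ≠ false} ≤ ∑ m ∈ msgs,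
            #{R : T | l ≤ #{k | S.result (R k) (alice x ++ bob i) m = some 1}} := by
          refine le_trans (card_le_card fun R hR => ?_) card_biUnion_le
          simp only [hres, mem_filter, mem_univ, true_and, ne_eq, decide_eq_false_iff_not,
            not_not] at hR
          obtain ⟨m, hm, hlt⟩ := hR
          exact mem_biUnion.2 ⟨m, hmsgs m hm, by simpa using hlt.le⟩
        calc _ ≤ (∑ m ∈ msgs,
              #{R : T | l ≤ #{k | S.result (R k) (alice x ++ bob i) m = some 1}}) * 9 ^ l :=
              Nat.mul_le_mul_right _ hsub
          _ ≤ ∑ m ∈ msgs, 8 ^ l * Fintype.card (Fin S.coins) ^ (2 * l) := by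
              rw [sum_mul]
              exact sum_le_sum fun m _ => card_half_bad_mul_le _ (hbad m) l
          _ ≤ _ := by
              rw [sum_const, smul_eq_mul]
              exact Nat.mul_le_mul_right _ hmsgs_card
      · obtain ⟨m, hm, hprob⟩ := hc _ (hD x i)
        have hbad := three_mul_card_not_le_of_le_prob hprob
        simp only [hf, hx, if_true] at hbad
        have hsub : #{R : T | dec R (enc R x) i ≠ true} ≤
            #{R : T | l ≤ #{k | ¬ S.result (R k) (alice x ++ bob i) m = some 1}} := by
          refine card_le_card (monotone_filter_right _ fun R _ hR => ?_)
          simp only [hres, ne_eq, decide_eq_true_eq, not_exists, not_and, not_lt] at hR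
          have h₁ := hR m hm
          have h₂ := card_filter_add_card_filter_not (s := (univ : Finset (Fin (2 * l))))
            (fun k => S.result (R k) (alice x ++ bob i) m = some 1)
          rw [card_univ, Fintype.card_fin] at h₂
          omega
        exact (Nat.mul_le_mul_right _ hsub).trans ((card_half_bad_mul_le _ hbad l).trans
          (Nat.le_mul_of_pos_left _ (by positivity)))
    rw [Fintype.card_fin, ← hT] at hmain
    calc 9 ^ l * (16 * #{R : T | dec R (enc R x) i ≠ x i})
        = 16 * (#{R : T | dec R (enc R x) i ≠ x i} * 9 ^ l) := by ring
      _ ≤ 16 * (2 ^ (h + 1) * (8 ^ l * Fintype.card T)) := Nat.mul_le_mul_left _ hmain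
      _ = 2 ^ (h + 5) * 8 ^ l * Fintype.card T := by ring
      _ ≤ _ := Nat.mul_le_mul_right _ h89
  -- some outcome of the coins is at least as good as the average one
  obtain ⟨R, -, hR⟩ : ∃ R ∈ (univ : Finset T),
      16 * ∑ x, #{i | dec R (enc R x) i ≠ x i} ≤ 2 ^ N * N := by
    have hne : (univ : Finset T).Nonempty := ⟨fun _ => ⟨0, S.coins_pos⟩, mem_univ _⟩
    refine exists_le_of_sum_le hne ?_
    calc ∑ R : T, 16 * ∑ x, #{i | dec R (enc R x) i ≠ x i}
        = ∑ x : ι → Bool, ∑ i, 16 * #{R : T | dec R (enc R x) i ≠ x i} := by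
          simp only [← mul_sum, card_filter]
          rw [sum_comm]
          congr 1
          exact sum_congr rfl fun x _ => sum_comm
      _ ≤ ∑ x : ι → Bool, ∑ i : ι, Fintype.card T :=
          sum_le_sum fun x _ => sum_le_sum fun i _ => herr x i
      _ = ∑ R : T, 2 ^ N * N := by
          simp [hN]; ring
  have hexp := exp_le_card_of_recover (enc R) (dec R) hR
  have hcard : (Fintype.card (Fin (2 * l) → (Fin S.space → Bool)) : ℝ) ≤
      Real.exp ((2 * l * S.space : ℕ) : ℝ) := by
    have h2 : (2 : ℝ) ≤ Real.exp 1 := by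
      have := Real.add_one_le_exp (1 : ℝ); linarith
    rw [← mul_one ((2 * l * S.space : ℕ) : ℝ), Real.exp_nat_mul]
    calc _ = (2 : ℝ) ^ (2 * l * S.space) := by
          simp [← pow_mul, mul_comm]
      _ ≤ _ := by gcongr
  have hfin := Real.exp_le_exp.1 (hexp.trans hcard)
  rw [← hN] at hfin
  have : (N : ℝ) ≤ ((4 * (2 * l * S.space) : ℕ) : ℝ) := by push_cast at hfin ⊢; linarith
  have hfinal : N ≤ 4 * (2 * l * S.space) := by exact_mod_cast this
  refine hfinal.trans (le_of_eq ?_)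
  rw [hl]; ring

end Scheme

end IndexBound

/-! ### Index bits as triangles -/

namespace TriangleIndex

open Finset

variable {n p : ℕ}

/-- The bipartite graph on `{0, …, p - 1}` and `{p, …, 2 * p - 1}` with adjacency matrix `x`. -/
noncomputable def matrixStream (hp : 2 * p + 1 ≤ n) (x : Fin p × Fin p → Bool) :
    List (EdgeUpdate n) :=
  (univ : Finset (Fin p × Fin p)).toList.map fun k =>
    ⟨⟨k.1, by omega⟩, ⟨p + k.2, by omega⟩, by simp [Fin.ext_iff]; omega, if x k then 1 else 0⟩

/-- The two edges from the additional vertex `2 * p` to the row `k.1` and the column `k.2`. -/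
def entryStream (hp : 2 * p + 1 ≤ n) (k : Fin p × Fin p) : List (EdgeUpdate n) :=
  [⟨⟨k.1, by omega⟩, ⟨2 * p, by omega⟩, by simp [Fin.ext_iff]; omega, 1⟩,
    ⟨⟨p + k.2, by omega⟩, ⟨2 * p, by omega⟩, by simp [Fin.ext_iff]; omega, 1⟩]

theorem edgeMultiplicity_matrixStream (hp : 2 * p + 1 ≤ n) (x : Fin p × Fin p → Bool)
    (a b : Fin n) : edgeMultiplicity (matrixStream hp x) a b =
      ∑ k : Fin p × Fin p, if (k.1 : ℕ) = a ∧ p + k.2 = b ∨ (k.1 : ℕ) = b ∧ p + k.2 = a then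
        if x k then 1 else 0 else 0 := by
  simp only [edgeMultiplicity, matrixStream, List.map_map]
  rw [sum_map_toList]
  simp only [Function.comp_def, Sym2.eq_iff, Fin.ext_iff]

theorem edgeMultiplicity_matrixStream_apply (hp : 2 * p + 1 ≤ n) (x : Fin p × Fin p → Bool)
    (k : Fin p × Fin p) {a b : Fin n} (ha : (a : ℕ) = k.1) (hb : (b : ℕ) = p + k.2) :
    edgeMultiplicity (matrixStream hp x) a b = if x k then 1 else 0 := by
  rw [edgeMultiplicity_matrixStream, sum_eq_single k]
  · simp [ha, hb]
  · intro k' _ hk'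
    rw [if_neg]
    intro h
    apply hk'
    ext <;> omega
  · simp

theorem edgeMultiplicity_matrixStream_eq_zero (hp : 2 * p + 1 ≤ n) (x : Fin p × Fin p → Bool)
    {a b : Fin n} (h : ¬ ((a : ℕ) < p ∧ p ≤ (b : ℕ) ∧ (b : ℕ) < 2 * p))
    (h' : ¬ ((b : ℕ) < p ∧ p ≤ (a : ℕ) ∧ (a : ℕ) < 2 * p)) :
    edgeMultiplicity (matrixStream hp x) a b = 0 := by
  rw [edgeMultiplicity_matrixStream]
  refine sum_eq_zero fun k _ => if_neg ?_
  omega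

theorem edgeMultiplicity_matrixStream_mem (hp : 2 * p + 1 ≤ n) (x : Fin p × Fin p → Bool)
    (a b : Fin n) : 0 ≤ edgeMultiplicity (matrixStream hp x) a b ∧
      edgeMultiplicity (matrixStream hp x) a b ≤ 1 := by
  by_cases h : (a : ℕ) < p ∧ p ≤ (b : ℕ) ∧ (b : ℕ) < 2 * p
  · rw [edgeMultiplicity_matrixStream_apply hp x (⟨a, h.1⟩, ⟨b - p, by omega⟩) rfl
      (by simp only; omega)]
    split_ifs <;> simp
  by_cases h' : (b : ℕ) < p ∧ p ≤ (a : ℕ) ∧ (a : ℕ) < 2 * p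
  · rw [edgeMultiplicity_comm, edgeMultiplicity_matrixStream_apply hp x
      (⟨b, h'.1⟩, ⟨a - p, by omega⟩) rfl (by simp only; omega)]
    split_ifs <;> simp
  rw [edgeMultiplicity_matrixStream_eq_zero hp x h h']
  simp

theorem triangleCount_matrixStream (hp : 2 * p + 1 ≤ n) (x : Fin p × Fin p → Bool) :
    triangleCount (matrixStream hp x) = 0 := by
  refine sum_eq_zero fun a _ => sum_eq_zero fun b _ => sum_eq_zero fun c _ => ?_
  split_ifs with h
  · have h₁ : (a : ℕ) < b := h.1
    have h₂ : (b : ℕ) < c := h.2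
    by_cases hb : (b : ℕ) < p
    · rw [edgeMultiplicity_matrixStream_eq_zero hp x (a := a) (b := b) (by omega) (by omega)]
      simp
    · rw [edgeMultiplicity_matrixStream_eq_zero hp x (a := b) (b := c) (by omega) (by omega)]
      simp
  · rfl

theorem append_entryStream_mem (hp : 2 * p + 1 ≤ n) {M : ℕ} (hM : 1 ≤ M)
    (x : Fin p × Fin p → Bool) (k : Fin p × Fin p) :
    matrixStream hp x ++ entryStream hp k ∈ multigraphStreams n M := by
  intro a b
  have hM' : (1 : ℤ) ≤ M := by exact_mod_cast hM
  have h₁ := edgeMultiplicity_matrixStream_mem hp x a b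
  have h₂ : (a : ℕ) = 2 * p ∨ (b : ℕ) = 2 * p →
      edgeMultiplicity (matrixStream hp x) a b = 0 := fun h =>
    edgeMultiplicity_matrixStream_eq_zero hp x (by omega) (by omega)
  rw [edgeMultiplicity_append, entryStream, ← List.singleton_append, edgeMultiplicity_append,
    edgeMultiplicity_singleton, edgeMultiplicity_singleton]
  simp only [Sym2.eq_iff, Fin.ext_iff]
  split_ifs <;> omega

/-- The row and the column at the two edges to the additional vertex are adjacent exactly if the
corresponding bit of the matrix is set. -/
theorem triangleCount_append_entryStream (hp : 2 * p + 1 ≤ n) (x : Fin p × Fin p → Bool)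
    (k : Fin p × Fin p) :
    triangleCount (matrixStream hp x ++ entryStream hp k) = if x k then 1 else 0 := by
  rw [entryStream, ← List.singleton_append, ← List.append_assoc, triangleCount_concat,
    triangleCount_concat, triangleCount_matrixStream]
  have h₀ : ∀ w, edgeMultiplicity (matrixStream hp x) (⟨2 * p, by omega⟩ : Fin n) w = 0 :=
    fun w => edgeMultiplicity_matrixStream_eq_zero hp x (by simp only; omega) (by simp only; omega)
  simp only [h₀, mul_zero, sum_const_zero, zero_add, one_mul, edgeMultiplicity_append,
    edgeMultiplicity_singleton, Sym2.eq_iff, Fin.ext_iff]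
  rw [sum_eq_single ⟨k.1, by omega⟩]
  · rw [edgeMultiplicity_comm, edgeMultiplicity_matrixStream_apply hp x k rfl rfl,
      if_neg (c := _ ∨ _) (by omega), if_pos (c := _ ∨ _) (Or.inr ⟨rfl, trivial⟩),
      add_zero, mul_one]
  · intro w _ hw
    have : (k.1 : ℕ) ≠ w := fun h => hw (Fin.ext h.symm)
    split_ifs <;> omega
  · simp

end TriangleIndex

theorem sq_le_help_mul_space {n M h v : ℕ} (hM : 1 ≤ M) (hh : 1 ≤ h) (hv : 1 ≤ v)
    {S : Scheme (EdgeUpdate n) ℤ} (hS : S.space ≤ v)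
    (hc : S.IsComplete (multigraphStreams n M) triangleCount h (1 / 3))
    (hs : S.IsSound (multigraphStreams n M) triangleCount (1 / 3)) :
    n ^ 2 ≤ 4608 * (h * v) := by
  have hhv : 1 ≤ h * v := Nat.mul_pos hh hv
  rcases Nat.lt_or_ge n 3 with hn | hn
  · have : n ^ 2 ≤ 2 ^ 2 := Nat.pow_le_pow_left (by omega) 2
    omega
  · obtain ⟨p, hp, hp'⟩ : ∃ p, 2 * p + 1 ≤ n ∧ n ≤ 4 * p := ⟨(n - 1) / 2, by omega, by omega⟩
    have hcard := Scheme.card_le_of_index hc hs (TriangleIndex.matrixStream hp)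
      (TriangleIndex.entryStream hp) (TriangleIndex.append_entryStream_mem hp hM)
      (TriangleIndex.triangleCount_append_entryStream hp)
    simp only [Fintype.card_prod, Fintype.card_fin] at hcard
    calc n ^ 2 ≤ (4 * p) ^ 2 := Nat.pow_le_pow_left hp' 2
      _ = 16 * (p * p) := by ring
      _ ≤ 16 * (48 * (6 * h) * v) := by
          refine Nat.mul_le_mul_left _ (hcard.trans (Nat.mul_le_mul ?_ hS))
          omega
      _ = _ := by ring

theorem mainTheorem2 :
    -- the scheme: help cost of order `t` and verification cost of order `n * s`, up to
    -- factors polynomial in `log n`; the stored coins are charged as well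
    (∀ C : ℕ, ∃ K k : ℕ, ∀ n M t s : ℕ, 1 ≤ n → M ≤ n ^ C → 1 ≤ t → 1 ≤ s → n ≤ t * s →
      ∃ S : Scheme (EdgeUpdate n) ℤ,
        S.space ≤ K * (n * s) * (Nat.log 2 n + 1) ^ k ∧
        S.coins ≤ 2 ^ (K * (n * s) * (Nat.log 2 n + 1) ^ k) ∧
        S.IsComplete (multigraphStreams n M) triangleCount
          (K * t * (Nat.log 2 n + 1) ^ k) 0 ∧
        S.IsSound (multigraphStreams n M) triangleCount (1 / 3)) ∧
    -- optimality: every scheme has `h * v` of order at least `n ^ 2`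
    (∃ c : ℝ, 0 < c ∧ ∀ n M h v : ℕ, 1 ≤ M → 1 ≤ h → 1 ≤ v →
      ∀ S : Scheme (EdgeUpdate n) ℤ, S.space ≤ v →
        S.IsComplete (multigraphStreams n M) triangleCount h (1 / 3) →
        S.IsSound (multigraphStreams n M) triangleCount (1 / 3) →
        c * (n : ℝ) ^ 2 ≤ (h : ℝ) * (v : ℝ)) := by
  refine ⟨LaconicTriangle.exists_scheme, 1 / 4608, by norm_num,
    fun n M h v hM hh hv S hS hc hs => ?_⟩
  have key : (n : ℝ) ^ 2 ≤ 4608 * ((h : ℝ) * v) := by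
    exact_mod_cast sq_le_help_mul_space hM hh hv hS hc hs
  linarith
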